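/- Let $\phi,\psi:\mathbb R\to\mathbb R$ be compactly supported father and mother wavelets, $\psi$ bounded, such that $\{\phi(\cdot-k)\}_{k\in\mathbb Z}\cup\{2^{j/2}\psi(2^j\cdot-k)\}_{j\ge 0,\,k\in\mathbb Z}$ is an orthonormal basis of $L^2(\mathbb R)$, and let $\psi_{j,k}(x)=\sum_{l\in\mathbb Z}2^{j/2}\psi(2^j(x-l)-k)$ be the periodized wavelets. Consider the regression model with random design $$Y_i=f(X_i)+z_i,\qquad i=1,\dots,n,$$ where $X_1,\dots,X_n$ are i.i.d. in $[0,1]$ with density $g$, and $z_1,\dots,z_n$ are i.i.d. $N(0,1)$ and independent of $(X_1,\dots,X_n)$. Assume that $|f|\le M'$ and $c\le g\le G$ almost everywhere on $[0,1]$, where $M'>0$ and $0<c\le G<\infty$. Set $$\beta_{j,k}=\int_0^1 f(x)\psi_{j,k}(x)\,dx,\qquad \hat\beta_{j,k}=n^{-1}\sum_{i=1}^n Y_i\,g(X_i)^{-1}\psi_{j,k}(X_i).$$ For $p\in[2,\infty)$ let $L=\lfloor(\log n)^{p/2}\rfloor$, $j_1=\lfloor (p/2)\log_2(\log n)\rfloor$,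 $j_2=\lfloor(1/2)\log_2(n/\log n)\rfloor$, $\mathcal A_j=\{1,\dots,\lceil 2^jL^{-1}\rceil\}$, and, for $K\in\mathcal A_j$, $\mathcal B_{j,K}=\{k\in\{0,\dots,2^j-1\}:(K-1)L\le k\le KL-1\}$. **Proposition.** Let $p\ge2$. There exist constants $\mu_1>0$ and $C>0$ and an integer $N$, depending only on $p,\phi,\psi,M',c,G$, such that for all $n\ge N$, all measurable $f$ and $g$ as above, and all integers $j$ with $j_1\le j\le j_2$: * for all $k\in\{0,\dots,2^j-1\}$, $|\hat\beta_{j,k}-\beta_{j,k}|^{2p}$ is integrable and $$\mathbb E\left(|\hat\beta_{j,k}-\beta_{j,k}|^{2p}\right)\le C n^{-p};$$ * for all $K\in\mathcal A_j$, $$\mathbb P\left(\Big[L^{-1}\sum_{k\in\mathcal B_{j,K}}|\hat\beta_{j,k}-\beta_{j,k}|^p\Big]^{1/p}\ge \mu_1 2^{-1}n^{-1/2}\right)\le 4n^{-p}.$$ -/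

import Mathlib

open MeasureTheory ProbabilityTheory

noncomputable section

namespace WaveletRegression

/-- The dilated and translated function `h_{j,k}(x) = 2^{j/2} h(2^j x - k)`. -/
def dilate (h : ℝ → ℝ) (j : ℕ) (k : ℤ) (x : ℝ) : ℝ :=
  (2 : ℝ) ^ ((j : ℝ) / 2) * h (2 ^ j * x - k)

/-- The inhomogeneous wavelet system on the line:
`φ_{0,k}`, `k ∈ ℤ`, together with `ψ_{j,k}`, `j ≥ 0`, `k ∈ ℤ`. -/
def waveletSystem (φ ψ : ℝ → ℝ) : ℤ ⊕ (ℕ × ℤ) → ℝ → ℝ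
  | Sum.inl k => dilate φ 0 k
  | Sum.inr jk => dilate ψ jk.1 jk.2

/-- `φ` and `ψ` are compactly supported father and mother wavelets (with `ψ` bounded) generating
an orthonormal wavelet basis of `L²(ℝ)` by dilation and translation. -/
structure IsWaveletPair (φ ψ : ℝ → ℝ) : Prop where
  measurable_father : Measurable φ
  measurable_mother : Measurable ψ
  hasCompactSupport_father : HasCompactSupport φ
  hasCompactSupport_mother : HasCompactSupport ψ
  bounded_mother : ∃ B : ℝ, ∀ x, |ψ x| ≤ B
  orthonormal_basis : ∃ b : HilbertBasis (ℤ ⊕ (ℕ × ℤ)) ℝ (Lp ℝ 2 (volume : Measure ℝ)),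
    ∀ i, (b i : ℝ → ℝ) =ᵐ[volume] waveletSystem φ ψ i

/-- The periodized wavelet `ψ^{per}_{j,k}(x) = ∑_{l ∈ ℤ} ψ_{j,k}(x - l)`. -/
def periodized (ψ : ℝ → ℝ) (j k : ℕ) (x : ℝ) : ℝ :=
  ∑' l : ℤ, dilate ψ j k (x - l)

/-- The wavelet coefficient `β_{j,k} = ∫₀¹ f(x) ψ^{per}_{j,k}(x) dx`. -/
def waveletCoeff (ψ f : ℝ → ℝ) (j k : ℕ) : ℝ :=
  ∫ x in Set.Icc (0 : ℝ) 1, f x * periodized ψ j k x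

/-- The empirical wavelet coefficient
`β̂_{j,k} = n⁻¹ ∑_{i} Y_i g(X_i)⁻¹ ψ^{per}_{j,k}(X_i)`, from the data `x_i`, `y_i`. -/
def empiricalCoeff (ψ g : ℝ → ℝ) {n : ℕ} (x y : Fin n → ℝ) (j k : ℕ) : ℝ :=
  (n : ℝ)⁻¹ * ∑ i, y i * (g (x i))⁻¹ * periodized ψ j k (x i)

/-- The block length `L = ⌊(log n)^{p/2}⌋`. -/
def blockLength (p : ℝ) (n : ℕ) : ℕ :=
  ⌊Real.log n ^ (p / 2)⌋₊

/-- The coarsest level `j₁ = ⌊(p/2) log₂ (log n)⌋` (nonnegative as soon as `n ≥ 3`). -/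
def coarsestLevel (p : ℝ) (n : ℕ) : ℕ :=
  ⌊p / 2 * Real.logb 2 (Real.log n)⌋₊

/-- The finest level `j₂ = ⌊(1/2) log₂ (n / log n)⌋` (nonnegative as soon as `n ≥ 3`). -/
def finestLevel (n : ℕ) : ℕ :=
  ⌊1 / 2 * Real.logb 2 (n / Real.log n)⌋₊

/-- The set `𝓐_j = {1, …, 2^j / L}` of block indices at level `j`. The upper end is rounded up, so
that the blocks always cover `{0, …, 2^j - 1}`: when `L` does not divide `2^j`, the last,
incomplete block is included. -/
def blockIndices (p : ℝ) (n j : ℕ) : Finset ℕ :=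
  Finset.Icc 1 ⌈(2 : ℝ) ^ j / (blockLength p n : ℝ)⌉₊

/-- The block `𝓑_{j,K} = {k ∈ {0, …, 2^j - 1} : (K - 1) L ≤ k ≤ K L - 1}`, for `K ≥ 1`. -/
def block (p : ℝ) (n j K : ℕ) : Finset ℕ :=
  (Finset.range (2 ^ j)).filter fun k =>
    (K - 1) * blockLength p n ≤ k ∧ k < K * blockLength p n

/-- `n` observations of the regression model with random design `Y_i = f(X_i) + z_i`: the `X_i`
are i.i.d. on `[0, 1]` with density `g`, the errors `z_i` are i.i.d. standard Gaussian, and the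
vector of the `z_i` is independent of the vector of the `X_i`. -/
structure IsRandomDesignSample {Ω : Type*} [MeasurableSpace Ω] (P : Measure Ω) (f g : ℝ → ℝ)
    {n : ℕ} (X Y z : Fin n → Ω → ℝ) : Prop where
  measurable_design : ∀ i, Measurable (X i)
  measurable_noise : ∀ i, Measurable (z i)
  law_design : ∀ i, P.map (X i) =
    (volume.restrict (Set.Icc (0 : ℝ) 1)).withDensity fun x => ENNReal.ofReal (g x)
  law_noise : ∀ i, P.map (z i) = gaussianReal 0 1
  indep_design : iIndepFun X P
  indep_noise : iIndepFun z P
  indep_design_noise : IndepFun (fun ω i => X i ω) (fun ω i => z i ω) P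
  regression : ∀ i ω, Y i ω = f (X i ω) + z i ω

end WaveletRegression

end

/-!
The errors `√n (β̂_{j,k} - β_{j,k})` within one level are treated jointly. Conditioning on the
design integrates out the Gaussian noise, and the second-order expansion of `exp` then bounds the
joint log-MGF of the errors, on a cube `|t_k| ≤ T` with `T` of order `√(log n)`, by that of
independent centered Gaussians of a fixed variance `v`. The wavelets enter through the bounds
`∑_k |ψ_{j,k}| = O(2^{j/2})` and `∫ |ψ_{j,k}| = O(2^{-j/2})`, which control the covariances by
Schur's test, and the constraint `2^j log n ≤ n` makes the cube admissible.

The moment bound is the one-dimensional Chernoff bound at a fixed radius. For the block, discard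
the event `|W_k| > v T` for some `k`, which has probability `O(n⁻ᵖ)`. For `|w| ≤ v T` and `ε` of
order `T^{2-p}`, the power `ε |w|^p` is dominated by a small multiple of `w²`, so that
`exp (ε |w|^p)` is at most `1` plus `ε` times a finite mixture of exponentials `exp (t w)`,
`|t| ≤ T`. Products of such mixtures are sums of joint exponentials, so
`E ∏_k exp (ε |W_k|^p) ≤ exp (O(ε L))`. As `ε L` is of order `log n`, Markov's inequality beats
`n⁻ᵖ` as soon as the level of the average exceeds a large constant.
-/

namespace WaveletRegression

/-- A version with parameters on a cube of `ProbabilityTheory.HasSubgaussianMGF`: the joint moment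
generating function of the family `W` is dominated, for parameters in the cube `[-T, T]^ι`, by that
of independent centered Gaussian variables of variance `v`. It is stated with the lower Lebesgue
integral, so that integrability is part of the bound. -/
def HasJointSubgaussianMGF {Ω ι : Type*} [MeasurableSpace Ω] [Fintype ι] (W : ι → Ω → ℝ)
    (v T : ℝ) (P : Measure Ω) : Prop :=
  ∀ t : ι → ℝ, (∀ k, |t k| ≤ T) →
    ∫⁻ ω, ENNReal.ofReal (Real.exp (∑ k, t k * W k ω)) ∂P ≤
      ENNReal.ofReal (Real.exp (v * (∑ k, t k ^ 2) / 2))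

section Elementary

open Real

theorem meas_ge_le_of_lintegral_exp_le {Ω : Type*} [MeasurableSpace Ω] {μ : Measure Ω}
    {F : Ω → ℝ} {a : ℝ} (hF : Measurable F)
    (h : ∫⁻ ω, ENNReal.ofReal (exp (F ω)) ∂μ ≤ ENNReal.ofReal (exp a)) (x : ℝ) :
    μ {ω | x ≤ F ω} ≤ ENNReal.ofReal (exp (a - x)) := by
  calc μ {ω | x ≤ F ω}
      ≤ μ {ω | ENNReal.ofReal (exp x) ≤ ENNReal.ofReal (exp (F ω))} :=
        measure_mono fun ω hω ↦ ENNReal.ofReal_le_ofReal (exp_le_exp.2 hω)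
    _ ≤ (∫⁻ ω, ENNReal.ofReal (exp (F ω)) ∂μ) / ENNReal.ofReal (exp x) :=
        meas_ge_le_lintegral_div (by fun_prop) (by simp [exp_pos]) ENNReal.ofReal_ne_top
    _ ≤ ENNReal.ofReal (exp a) / ENNReal.ofReal (exp x) := by gcongr
    _ = ENNReal.ofReal (exp (a - x)) := by
        rw [← ENNReal.ofReal_div_of_pos (exp_pos x), exp_sub]

theorem exp_mul_rpow_abs_le {p r M w : ℝ} (hp : 2 ≤ p) (hr : 0 < r) (hM : 0 < M) (hw : |w| ≤ M) :
    exp (r * M ^ (2 - p) * |w| ^ p) ≤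
      1 + r * M ^ (2 - p) * (p ^ p * exp (1 / (4 * r))) * exp (2 * r * w ^ 2) := by
  have exp_le (y : ℝ) : exp y ≤ 1 + y * exp y := by
    have h := mul_le_mul_of_nonneg_right (one_sub_le_exp_neg y) (exp_pos y).le
    rw [← exp_add, neg_add_cancel, exp_zero] at h
    linarith
  have quadratic : r * M ^ (2 - p) * |w| ^ p ≤ r * w ^ 2 := by
    rw [mul_assoc]
    gcongr
    calc M ^ (2 - p) * |w| ^ p = M ^ (2 - p) * |w| ^ (p - 2) * w ^ 2 := by
          rw [mul_assoc, ← sq_abs w, ← rpow_natCast |w| 2,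
            ← rpow_add_of_nonneg (abs_nonneg w) (by linarith) (by norm_num)]
          norm_num
      _ ≤ M ^ (2 - p) * M ^ (p - 2) * w ^ 2 := by gcongr
      _ = w ^ 2 := by rw [← rpow_add hM]; simp
  have polynomial : |w| ^ p ≤ p ^ p * exp (1 / (4 * r) + r * w ^ 2) := by
    have amgm : |w| ≤ 1 / (4 * r) + r * w ^ 2 := by
      have : 1 / (4 * r) + r * w ^ 2 - |w| = (2 * r * |w| - 1) ^ 2 / (4 * r) := by
        rw [← sq_abs w]; field_simp; ring
      linarith [show 0 ≤ (2 * r * |w| - 1) ^ 2 / (4 * r) by positivity]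
    calc |w| ^ p ≤ p ^ p * exp |w| := by
          simpa using rpow_abs_le_mul_exp_abs w (by linarith : 0 ≤ p) one_ne_zero
      _ ≤ _ := by gcongr
  calc exp (r * M ^ (2 - p) * |w| ^ p)
      ≤ 1 + r * M ^ (2 - p) * |w| ^ p * exp (r * M ^ (2 - p) * |w| ^ p) := exp_le _
    _ ≤ 1 + r * M ^ (2 - p) * (p ^ p * exp (1 / (4 * r) + r * w ^ 2)) * exp (r * w ^ 2) := by
        gcongr
    _ = 1 + r * M ^ (2 - p) * (p ^ p * exp (1 / (4 * r))) * exp (2 * r * w ^ 2) := by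
        rw [exp_add, show 2 * r * w ^ 2 = r * w ^ 2 + r * w ^ 2 by ring, exp_add]; ring

/-- A square is linearized by a discrete mixture of exponentials, a substitute for the Gaussian
mixture of the Hubbard–Stratonovich transform that only involves bounded parameters. -/
theorem exp_mul_sq_le_sum {lam M w : ℝ} (hlam : 0 ≤ lam) (hw : |w| ≤ M) :
    exp (lam * w ^ 2) ≤
      exp lam * ∑ a ∈ Finset.Icc ⌈-M⌉ ⌊M⌋, exp (-(lam * a ^ 2)) * exp (2 * lam * a * w) := by
  obtain ⟨hw₁, hw₂⟩ := abs_le.1 hw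
  obtain ⟨a, ha, haw⟩ : ∃ a ∈ Finset.Icc ⌈-M⌉ ⌊M⌋, (w - a) ^ 2 ≤ 1 := by
    simp only [Finset.mem_Icc, Int.ceil_le, Int.le_floor, sq_le_one_iff_abs_le_one, abs_le]
    rcases le_total 0 w with h | h
    · have := Int.floor_le w
      have := Int.lt_floor_add_one w
      have : (0 : ℝ) ≤ ⌊w⌋ := mod_cast Int.floor_nonneg.2 h
      exact ⟨⌊w⌋, ⟨by linarith, by linarith⟩, by linarith, by linarith⟩
    · have := Int.le_ceil w
      have := Int.ceil_lt_add_one w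
      have : (⌈w⌉ : ℝ) ≤ 0 := mod_cast Int.ceil_le.2 (by simpa using h)
      exact ⟨⌈w⌉, ⟨by linarith, by linarith⟩, by linarith, by linarith⟩
  calc exp (lam * w ^ 2)
      = exp (lam * (w - a) ^ 2) * (exp (-(lam * a ^ 2)) * exp (2 * lam * a * w)) := by
        rw [← exp_add, ← exp_add]; ring_nf
    _ ≤ exp lam * (exp (-(lam * a ^ 2)) * exp (2 * lam * a * w)) := by
        gcongr
        nlinarith
    _ ≤ _ := by
        gcongr
        exact Finset.single_le_sum
          (f := fun a : ℤ ↦ exp (-(lam * a ^ 2)) * exp (2 * lam * a * w))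
          (fun _ _ ↦ by positivity) ha

theorem exp_mul_rpow_abs_le_one_add_sum {p r M w : ℝ} (hp : 2 ≤ p) (hr : 0 < r) (hM : 0 < M)
    (hw : |w| ≤ M) :
    exp (r * M ^ (2 - p) * |w| ^ p) ≤
      1 + r * M ^ (2 - p) * (p ^ p * exp (1 / (4 * r)) * exp (2 * r)) *
        ∑ a ∈ Finset.Icc ⌈-M⌉ ⌊M⌋, exp (-(2 * r * a ^ 2)) * exp (2 * (2 * r) * a * w) := by
  refine (exp_mul_rpow_abs_le hp hr hM hw).trans ?_
  rw [← mul_assoc _ (p ^ p * _), mul_assoc _ (exp (2 * r))]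
  gcongr
  exact exp_mul_sq_le_sum (by positivity) hw

theorem summable_exp_neg_mul_int_sq {r : ℝ} (hr : 0 < r) :
    Summable fun a : ℤ ↦ exp (-(r * a ^ 2)) := by
  have h := Real.summable_exp_nat_mul_of_ge (neg_lt_zero.2 hr) (f := fun a ↦ (a : ℝ) ^ 2)
    fun a ↦ mod_cast Nat.le_self_pow two_ne_zero a
  refine .of_nat_of_neg ?_ ?_ <;> simpa [neg_mul] using h

/-- The constant in the exponential `p`-th moment bound
`HasJointSubgaussianMGF.setLIntegral_exp_sum_rpow_le`. -/
noncomputable def momentConst (p r : ℝ) : ℝ :=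
  p ^ p * exp (1 / (4 * r)) * exp (2 * r) * ∑' a : ℤ, exp (-(r * a ^ 2))

theorem momentConst_nonneg {p : ℝ} (hp : 0 ≤ p) (r : ℝ) : 0 ≤ momentConst p r := by
  have : 0 ≤ ∑' a : ℤ, exp (-(r * a ^ 2)) := tsum_nonneg fun _ ↦ (exp_pos _).le
  unfold momentConst
  positivity

end Elementary

section JointSubgaussian

open Real

variable {Ω ι : Type*} [MeasurableSpace Ω] [Fintype ι] {P : Measure Ω} {W : ι → Ω → ℝ} {v T : ℝ}

theorem HasJointSubgaussianMGF.lintegral_exp_mul_le (h : HasJointSubgaussianMGF W v T P) (k : ι)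
    {t : ℝ} (ht : |t| ≤ T) :
    ∫⁻ ω, ENNReal.ofReal (exp (t * W k ω)) ∂P ≤ ENNReal.ofReal (exp (v * t ^ 2 / 2)) := by
  classical
  have h := h (Pi.single k t) fun i ↦ by
    rcases eq_or_ne i k with rfl | hi
    · simpa using ht
    · simpa [hi] using (abs_nonneg t).trans ht
  simpa [Pi.single_apply, ite_pow] using h

theorem HasJointSubgaussianMGF.integrable_and_integral_rpow_le
    (h : HasJointSubgaussianMGF W v T P) (hW : ∀ k, Measurable (W k)) (k : ι) {q t : ℝ}
    (hq : 0 ≤ q) (ht : 0 < t) (htT : t ≤ T) :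
    Integrable (fun ω ↦ |W k ω| ^ q) P ∧
      ∫ ω, |W k ω| ^ q ∂P ≤ 2 * (q / t) ^ q * exp (v * t ^ 2 / 2) := by
  have hWk := hW k
  have pointwise (w : ℝ) : |w| ^ q ≤ (q / t) ^ q * (exp (t * w) + exp (-t * w)) := by
    refine (rpow_abs_le_mul_max_exp_of_pos w hq ht).trans ?_
    gcongr
    exact max_le_add_of_nonneg (exp_pos _).le (exp_pos _).le
  have bound : ∫⁻ ω, ENNReal.ofReal (|W k ω| ^ q) ∂P ≤
      ENNReal.ofReal (2 * (q / t) ^ q * exp (v * t ^ 2 / 2)) := by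
    calc ∫⁻ ω, ENNReal.ofReal (|W k ω| ^ q) ∂P
        ≤ ∫⁻ ω, ENNReal.ofReal ((q / t) ^ q) * (ENNReal.ofReal (exp (t * W k ω)) +
            ENNReal.ofReal (exp (-t * W k ω))) ∂P := by
          refine lintegral_mono fun ω ↦ (ENNReal.ofReal_le_ofReal (pointwise _)).trans_eq ?_
          rw [ENNReal.ofReal_mul (by positivity), ENNReal.ofReal_add (by positivity)
            (by positivity)]
      _ = ENNReal.ofReal ((q / t) ^ q) * (∫⁻ ω, ENNReal.ofReal (exp (t * W k ω)) ∂P +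
            ∫⁻ ω, ENNReal.ofReal (exp (-t * W k ω)) ∂P) := by
          rw [lintegral_const_mul _ (by fun_prop), lintegral_add_left (by fun_prop)]
      _ ≤ ENNReal.ofReal ((q / t) ^ q) * (ENNReal.ofReal (exp (v * t ^ 2 / 2)) +
            ENNReal.ofReal (exp (v * (-t) ^ 2 / 2))) := by
          have ht' : |t| ≤ T := by rwa [abs_of_pos ht]
          gcongr
          · exact h.lintegral_exp_mul_le k ht'
          · exact h.lintegral_exp_mul_le k (by rwa [abs_neg])
      _ = ENNReal.ofReal (2 * (q / t) ^ q * exp (v * t ^ 2 / 2)) := by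
          rw [← ENNReal.ofReal_add (by positivity) (by positivity),
            ← ENNReal.ofReal_mul (by positivity), neg_sq]
          ring_nf
  have nonneg (ω : Ω) : 0 ≤ |W k ω| ^ q := by positivity
  have measurable : AEStronglyMeasurable (fun ω ↦ |W k ω| ^ q) P := by fun_prop
  refine ⟨⟨measurable, ?_⟩, ?_⟩
  · rw [hasFiniteIntegral_iff_ofReal (.of_forall nonneg)]
    exact bound.trans_lt ENNReal.ofReal_lt_top
  · rw [integral_eq_lintegral_of_nonneg_ae (.of_forall nonneg) measurable]
    exact ENNReal.toReal_le_of_le_ofReal (by positivity) bound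

theorem HasJointSubgaussianMGF.measure_lt_abs_le (h : HasJointSubgaussianMGF W v T P)
    (hW : ∀ k, Measurable (W k)) (hT : 0 ≤ T) (k : ι) :
    P {ω | v * T < |W k ω|} ≤ ENNReal.ofReal (2 * exp (-(v * T ^ 2 / 2))) := by
  have hWk := hW k
  have one_sided {t : ℝ} (ht : |t| = T) :
      P {ω | v * T ^ 2 ≤ t * W k ω} ≤ ENNReal.ofReal (exp (-(v * T ^ 2 / 2))) := by
    convert meas_ge_le_of_lintegral_exp_le (by fun_prop) (h.lintegral_exp_mul_le k ht.le)
      (v * T ^ 2) using 3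
    rw [← ht, sq_abs]; ring
  calc P {ω | v * T < |W k ω|}
      ≤ P ({ω | v * T ^ 2 ≤ T * W k ω} ∪ {ω | v * T ^ 2 ≤ -T * W k ω}) := by
        refine measure_mono fun ω hω ↦ ?_
        rcases lt_abs.1 hω.out with hω | hω
        · exact Or.inl (show v * T ^ 2 ≤ T * W k ω by nlinarith)
        · exact Or.inr (show v * T ^ 2 ≤ -T * W k ω by nlinarith)
    _ ≤ _ := measure_union_le _ _
    _ ≤ ENNReal.ofReal (exp (-(v * T ^ 2 / 2))) + ENNReal.ofReal (exp (-(v * T ^ 2 / 2))) :=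
        add_le_add (one_sided (abs_of_nonneg hT)) (one_sided (by rw [abs_neg, abs_of_nonneg hT]))
    _ = ENNReal.ofReal (2 * exp (-(v * T ^ 2 / 2))) := by
        rw [← ENNReal.ofReal_add (by positivity) (by positivity), two_mul]

theorem ofReal_prod_sum_mul_exp [DecidableEq ι] {σ : Type*} {S : Finset σ} {b : σ → ℝ}
    (hb : ∀ a ∈ S, 0 ≤ b a) (F : σ → ι → ℝ) :
    ENNReal.ofReal (∏ k, ∑ a ∈ S, b a * exp (F a k)) =
      ∑ x ∈ Fintype.piFinset fun _ : ι ↦ S,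
        ENNReal.ofReal (∏ k, b (x k)) * ENNReal.ofReal (exp (∑ k, F (x k) k)) := by
  have hbx : ∀ x ∈ Fintype.piFinset (fun _ : ι ↦ S), 0 ≤ ∏ k, b (x k) := fun x hx ↦
    Finset.prod_nonneg fun k _ ↦ hb _ (Fintype.mem_piFinset.1 hx k)
  rw [Finset.prod_univ_sum]
  simp only [Finset.prod_mul_distrib, ← exp_sum]
  rw [ENNReal.ofReal_sum_of_nonneg fun x hx ↦ mul_nonneg (hbx x hx) (exp_pos _).le]
  exact Finset.sum_congr rfl fun x hx ↦ ENNReal.ofReal_mul (hbx x hx)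

theorem HasJointSubgaussianMGF.lintegral_prod_sum_exp_le (h : HasJointSubgaussianMGF W v T P)
    (hW : ∀ k, Measurable (W k)) {σ : Type*} {S : Finset σ} {b θ : σ → ℝ}
    (hb : ∀ a ∈ S, 0 ≤ b a) (hθ : ∀ a ∈ S, |θ a| ≤ T) :
    ∫⁻ ω, ENNReal.ofReal (∏ k, ∑ a ∈ S, b a * exp (θ a * W k ω)) ∂P ≤
      ENNReal.ofReal ((∑ a ∈ S, b a * exp (v * θ a ^ 2 / 2)) ^ Fintype.card ι) := by
  classical
  rw [← Finset.card_univ, ← Finset.prod_const, ofReal_prod_sum_mul_exp hb]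
  simp only [ofReal_prod_sum_mul_exp hb fun a k ↦ θ a * W k _]
  rw [lintegral_finsetSum _ fun x _ ↦ by fun_prop]
  refine Finset.sum_le_sum fun x hx ↦ ?_
  rw [lintegral_const_mul _ (by fun_prop), ← Finset.sum_div, ← Finset.mul_sum]
  gcongr
  exact h (fun k ↦ θ (x k)) fun k ↦ hθ _ (Fintype.mem_piFinset.1 hx k)

theorem exists_exp_rpow_abs_le_mixture {p : ℝ} (hp : 2 ≤ p) (hv : 0 < v) (hT : 0 < T) :
    ∃ (S : Finset (Option ℤ)) (b θ : Option ℤ → ℝ), (∀ a, 0 ≤ b a) ∧ (∀ a ∈ S, |θ a| ≤ T) ∧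
      (∀ w, |w| ≤ v * T →
        exp ((8 * v)⁻¹ * (v * T) ^ (2 - p) * |w| ^ p) ≤ ∑ a ∈ S, b a * exp (θ a * w)) ∧
      ∑ a ∈ S, b a * exp (v * θ a ^ 2 / 2) ≤
        exp ((8 * v)⁻¹ * (v * T) ^ (2 - p) * momentConst p (8 * v)⁻¹) := by
  set r := (8 * v)⁻¹ with hr_def
  have hr : 0 < r := by positivity
  set A := r * (v * T) ^ (2 - p) * (p ^ p * exp (1 / (4 * r)) * exp (2 * r)) with hA_def
  -- The index `none` carries the constant function `1`.
  let b : Option ℤ → ℝ := fun a ↦ a.elim 1 fun a ↦ A * exp (-(2 * r * a ^ 2))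
  let θ : Option ℤ → ℝ := fun a ↦ a.elim 0 fun a ↦ 2 * (2 * r) * a
  refine ⟨Finset.insertNone (Finset.Icc ⌈-(v * T)⌉ ⌊v * T⌋), b, θ, fun a ↦ ?_, ?_, fun w hw ↦ ?_,
    ?_⟩
  · cases a <;> simp only [b, Option.elim] <;> positivity
  · refine Finset.forall_mem_insertNone.2 ⟨by simpa [θ] using hT.le, fun a ha ↦ ?_⟩
    have ha : |(a : ℝ)| ≤ v * T := by simpa [Int.ceil_le, Int.le_floor, abs_le] using ha
    calc |θ a| = |(a : ℝ)| / (2 * v) := by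
          simp only [θ, Option.elim, hr_def, abs_mul, abs_inv, abs_of_pos hv, abs_two]
          field_simp; norm_num
      _ ≤ v * T / (2 * v) := by gcongr
      _ ≤ T := by field_simp; linarith
  · refine (exp_mul_rpow_abs_le_one_add_sum hp hr (by positivity) hw).trans_eq ?_
    simp only [Finset.sum_insertNone, b, θ, Option.elim, zero_mul, exp_zero, mul_one, mul_assoc,
      ← Finset.mul_sum, hA_def]
  · calc ∑ a ∈ Finset.insertNone (Finset.Icc ⌈-(v * T)⌉ ⌊v * T⌋), b a * exp (v * θ a ^ 2 / 2)
        = 1 + A * ∑ a ∈ Finset.Icc ⌈-(v * T)⌉ ⌊v * T⌋, exp (-(r * a ^ 2)) := by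
          simp only [Finset.sum_insertNone, Finset.mul_sum, b, θ, Option.elim, mul_assoc, ← exp_add]
          congr 1
          · simp
          · refine Finset.sum_congr rfl fun a _ ↦ ?_
            congr 2
            rw [hr_def]; field_simp; ring
      _ ≤ 1 + A * ∑' a : ℤ, exp (-(r * a ^ 2)) := by
          gcongr
          exact (summable_exp_neg_mul_int_sq hr).sum_le_tsum _ fun _ _ ↦ (exp_pos _).le
      _ = r * (v * T) ^ (2 - p) * momentConst p r + 1 := by rw [momentConst, hA_def]; ring
      _ ≤ _ := add_one_le_exp _

theorem HasJointSubgaussianMGF.setLIntegral_exp_sum_rpow_le (h : HasJointSubgaussianMGF W v T P)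
    (hW : ∀ k, Measurable (W k)) {p : ℝ} (hp : 2 ≤ p) (hv : 0 < v) (hT : 0 < T) :
    ∫⁻ ω in {ω | ∀ k, |W k ω| ≤ v * T},
        ENNReal.ofReal (exp ((8 * v)⁻¹ * (v * T) ^ (2 - p) * ∑ k, |W k ω| ^ p)) ∂P ≤
      ENNReal.ofReal (exp ((8 * v)⁻¹ * (v * T) ^ (2 - p) *
        (momentConst p (8 * v)⁻¹ * Fintype.card ι))) := by
  obtain ⟨S, b, θ, hb, hθ, pointwise, mixture⟩ := exists_exp_rpow_abs_le_mixture hp hv hT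
  calc _ ≤ ∫⁻ ω in {ω | ∀ k, |W k ω| ≤ v * T},
          ENNReal.ofReal (∏ k, ∑ a ∈ S, b a * exp (θ a * W k ω)) ∂P := by
        refine setLIntegral_mono' (by measurability) fun ω hω ↦ ?_
        rw [Finset.mul_sum, exp_sum]
        exact ENNReal.ofReal_le_ofReal
          (Finset.prod_le_prod (fun _ _ ↦ (exp_pos _).le) fun k _ ↦ pointwise _ (hω k))
    _ ≤ ∫⁻ ω, ENNReal.ofReal (∏ k, ∑ a ∈ S, b a * exp (θ a * W k ω)) ∂P :=
        setLIntegral_le_lintegral _ _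
    _ ≤ _ := h.lintegral_prod_sum_exp_le hW (fun a _ ↦ hb a) hθ
    _ ≤ _ := by
        rw [← mul_assoc, mul_comm _ (Fintype.card ι : ℝ), exp_nat_mul]
        gcongr
        exact Finset.sum_nonneg fun a _ ↦ mul_nonneg (hb a) (exp_pos _).le

theorem HasJointSubgaussianMGF.measure_le_sum_rpow_le (h : HasJointSubgaussianMGF W v T P)
    (hW : ∀ k, Measurable (W k)) {p : ℝ} (hp : 2 ≤ p) (hv : 0 < v) (hT : 0 < T) (x : ℝ) :
    P {ω | x ≤ ∑ k, |W k ω| ^ p} ≤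
      ENNReal.ofReal (Fintype.card ι * (2 * exp (-(v * T ^ 2 / 2))) +
        exp ((8 * v)⁻¹ * (v * T) ^ (2 - p) *
          (momentConst p (8 * v)⁻¹ * Fintype.card ι - x))) := by
  set ε := (8 * v)⁻¹ * (v * T) ^ (2 - p)
  have hε : 0 < ε := by positivity
  set A := {ω | ∀ k, |W k ω| ≤ v * T}
  have on_cube : P.restrict A {ω | x ≤ ∑ k, |W k ω| ^ p} ≤
      ENNReal.ofReal (exp (ε * (momentConst p (8 * v)⁻¹ * Fintype.card ι - x))) := by
    convert meas_ge_le_of_lintegral_exp_le (by fun_prop)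
      (h.setLIntegral_exp_sum_rpow_le hW hp hv hT) (ε * x) using 2
    · simp only [mul_le_mul_iff_right₀ hε, ε]
    · rw [mul_sub]
  have off_cube : P Aᶜ ≤ ENNReal.ofReal (Fintype.card ι * (2 * exp (-(v * T ^ 2 / 2)))) := by
    calc P Aᶜ ≤ P (⋃ k, {ω | v * T < |W k ω|}) := measure_mono fun ω hω ↦ by
          simpa [A] using hω
      _ ≤ ∑ k, P {ω | v * T < |W k ω|} := measure_iUnion_fintype_le _ _
      _ ≤ ∑ _k : ι, ENNReal.ofReal (2 * exp (-(v * T ^ 2 / 2))) :=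
          Finset.sum_le_sum fun k _ ↦ h.measure_lt_abs_le hW hT.le k
      _ = _ := by rw [Finset.sum_const, ← ENNReal.ofReal_nsmul, Finset.card_univ, nsmul_eq_mul]
  have measurable : MeasurableSet {ω | x ≤ ∑ k, |W k ω| ^ p} := by measurability
  calc P {ω | x ≤ ∑ k, |W k ω| ^ p}
      ≤ P (Aᶜ ∪ {ω | x ≤ ∑ k, |W k ω| ^ p} ∩ A) := measure_mono fun ω hω ↦ by
        by_cases hA : ω ∈ A
        exacts [Or.inr ⟨hω, hA⟩, Or.inl hA]
    _ ≤ _ := measure_union_le _ _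
    _ ≤ _ := add_le_add off_cube (by rwa [← Measure.restrict_apply measurable])
    _ = _ := (ENNReal.ofReal_add (by positivity) (by positivity)).symm

end JointSubgaussian

section BlockDeviation

open Real

/-- The `p`-th power of the size of the normalized `ℓᵖ` average of a jointly sub-Gaussian block
that is exceeded with probability `O(n⁻ᵖ)`; see
`HasJointSubgaussianMGF.measure_blockLength_mul_le_sum_rpow_le`. -/
noncomputable def deviationConst (p v : ℝ) : ℝ :=
  momentConst p (8 * v)⁻¹ + 16 * v * p * (2 * v * (p + 1)) ^ ((p - 2) / 2)

theorem deviationConst_pos {p v : ℝ} (hp : 0 < p) (hv : 0 < v) : 0 < deviationConst p v :=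
  add_pos_of_nonneg_of_pos (momentConst_nonneg hp.le _) (by positivity)

theorem one_le_log_natCast {n : ℕ} (hn : 3 ≤ n) : 1 ≤ log n := by
  rw [le_log_iff_exp_le (by positivity)]
  exact exp_one_lt_three.le.trans (mod_cast hn)

theorem exp_neg_mul_log_natCast {n : ℕ} (hn : 0 < n) (q : ℝ) :
    exp (-(q * log n)) = (n : ℝ) ^ (-q) := by
  rw [rpow_def_of_pos (mod_cast hn)]; ring_nf

theorem half_rpow_log_le_blockLength {p : ℝ} (hp : 0 ≤ p) {n : ℕ} (hn : 3 ≤ n) :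
    log n ^ (p / 2) / 2 ≤ blockLength p n := by
  have floor_pos : (1 : ℝ) ≤ ⌊log n ^ (p / 2)⌋₊ := mod_cast
    (Nat.one_le_floor_iff _).2 (one_le_rpow (one_le_log_natCast hn) (by positivity))
  have := Nat.lt_floor_add_one (log n ^ (p / 2))
  unfold blockLength
  linarith

theorem mul_log_le_mul_blockLength {p v : ℝ} (hp : 0 ≤ p) (hv : 0 < v) {n : ℕ} (hn : 3 ≤ n) :
    p * log n ≤ (8 * v)⁻¹ * (v * √(2 * (p + 1) * log n / v)) ^ (2 - p) *
      (blockLength p n * (16 * v * p * (2 * v * (p + 1)) ^ ((p - 2) / 2))) := by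
  have hl : 0 < log n := one_pos.trans_le (one_le_log_natCast hn)
  have truncation : (v * √(2 * (p + 1) * log n / v)) ^ (2 - p) =
      (2 * v * (p + 1)) ^ (-((p - 2) / 2)) * log n ^ (1 - p / 2) := by
    have : v * √(2 * (p + 1) * log n / v) = (2 * v * (p + 1) * log n) ^ (1 / 2 : ℝ) := by
      rw [← sqrt_eq_rpow, ← sqrt_sq hv.le, ← sqrt_mul (by positivity), sqrt_sq hv.le]
      field_simp
    rw [this, ← rpow_mul (by positivity), mul_rpow (by positivity) hl.le]
    ring_nf
  calc p * log n
      = (8 * v)⁻¹ * (v * √(2 * (p + 1) * log n / v)) ^ (2 - p) *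
          (log n ^ (p / 2) / 2 * (16 * v * p * (2 * v * (p + 1)) ^ ((p - 2) / 2))) := by
        rw [truncation, rpow_neg (by positivity), rpow_sub hl, rpow_one]
        field_simp
        ring
    _ ≤ _ := by
        gcongr
        exact half_rpow_log_le_blockLength hp hn

theorem HasJointSubgaussianMGF.measure_blockLength_mul_le_sum_rpow_le {Ω ι : Type*}
    [MeasurableSpace Ω] [Fintype ι] {P : Measure Ω} {W : ι → Ω → ℝ} {p v : ℝ} {n : ℕ}
    (h : HasJointSubgaussianMGF W v √(2 * (p + 1) * log n / v) P) (hW : ∀ k, Measurable (W k))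
    (hp : 2 ≤ p) (hv : 0 < v) (hn : 3 ≤ n) (hL : Fintype.card ι ≤ blockLength p n)
    (hcard : Fintype.card ι ≤ n) :
    P {ω | blockLength p n * deviationConst p v ≤ ∑ k, |W k ω| ^ p} ≤
      ENNReal.ofReal (3 * (n : ℝ) ^ (-p)) := by
  have hn₀ : 0 < n := by lia
  have hl : 0 < log n := one_pos.trans_le (one_le_log_natCast hn)
  have hT : 0 < √(2 * (p + 1) * log n / v) := by positivity
  refine (h.measure_le_sum_rpow_le hW hp hv hT _).trans (ENNReal.ofReal_le_ofReal ?_)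
  have off_cube : Fintype.card ι * (2 * exp (-(v * √(2 * (p + 1) * log n / v) ^ 2 / 2))) ≤
      2 * (n : ℝ) ^ (-p) := by
    calc _ = Fintype.card ι * (2 * (n : ℝ) ^ (-(p + 1))) := by
          rw [← exp_neg_mul_log_natCast hn₀, sq_sqrt (by positivity)]
          congr 4
          field_simp
      _ ≤ n * (2 * (n : ℝ) ^ (-(p + 1))) := by gcongr
      _ = 2 * (n : ℝ) ^ (-p) := by
          rw [mul_left_comm, neg_add, rpow_add (by positivity), rpow_neg_one]
          field_simp
  have on_cube : exp ((8 * v)⁻¹ * (v * √(2 * (p + 1) * log n / v)) ^ (2 - p) *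
      (momentConst p (8 * v)⁻¹ * Fintype.card ι - blockLength p n * deviationConst p v)) ≤
      (n : ℝ) ^ (-p) := by
    set ε := (8 * v)⁻¹ * (v * √(2 * (p + 1) * log n / v)) ^ (2 - p)
    rw [← exp_neg_mul_log_natCast hn₀, exp_le_exp]
    have center : ε * (momentConst p (8 * v)⁻¹ * Fintype.card ι) ≤
        ε * (momentConst p (8 * v)⁻¹ * blockLength p n) := by
      have := momentConst_nonneg (by linarith : 0 ≤ p) (8 * v)⁻¹
      gcongr
    have margin := mul_log_le_mul_blockLength (by linarith : 0 ≤ p) hv hn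
    rw [deviationConst]
    linarith
  linarith

theorem mul_rpow_le_sum_of_le_rpow_inv {ι : Type*} [Fintype ι] {n L p a : ℝ} {e : ι → ℝ}
    (hn : 0 < n) (hL : 0 < L) (hp : 0 < p) (ha : 0 ≤ a)
    (h : a * n ^ (-(1 / 2) : ℝ) ≤ (L⁻¹ * ∑ k, |e k| ^ p) ^ (1 / p)) :
    L * a ^ p ≤ ∑ k, |√n * e k| ^ p := by
  rw [one_div p, Real.le_rpow_inv_iff_of_pos (by positivity) (by positivity) hp,
    mul_rpow ha (by positivity), ← rpow_mul hn.le, le_inv_mul_iff₀ hL] at h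
  calc L * a ^ p = n ^ (p / 2) * (L * (a ^ p * n ^ (-(1 / 2) * p))) := by
        rw [mul_left_comm _ L, mul_left_comm _ (a ^ p), ← rpow_add hn]
        ring_nf
        simp
    _ ≤ n ^ (p / 2) * ∑ k, |e k| ^ p := by gcongr
    _ = ∑ k, |√n * e k| ^ p := by
        simp only [abs_mul, abs_of_nonneg (sqrt_nonneg n), Finset.mul_sum]
        refine Finset.sum_congr rfl fun k _ ↦ ?_
        rw [mul_rpow (by positivity) (by positivity), sqrt_eq_rpow, ← rpow_mul hn.le]
        ring_nf

theorem abs_rpow_two_mul_eq {n p : ℝ} (hn : 0 < n) (e : ℝ) :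
    |e| ^ (2 * p) = n ^ (-p) * |√n * e| ^ (2 * p) := by
  rw [abs_mul, abs_of_nonneg (sqrt_nonneg n), mul_rpow (by positivity) (by positivity),
    sqrt_eq_rpow, ← rpow_mul hn.le, ← mul_assoc, ← rpow_add hn]
  ring_nf
  simp

theorem card_block_le_blockLength (p : ℝ) (n j K : ℕ) :
    (block p n j K).card ≤ blockLength p n := by
  have hsub : block p n j K ⊆
      Finset.Ico ((K - 1) * blockLength p n) ((K - 1) * blockLength p n + blockLength p n) := by
    intro k hk
    rw [block, Finset.mem_filter] at hk
    obtain ⟨-, hk₁, hk₂⟩ := hk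
    refine Finset.mem_Ico.2 ⟨hk₁, hk₂.trans_le ?_⟩
    rcases K with _ | K <;> simp [add_mul]
  simpa using Finset.card_le_card hsub

theorem two_pow_mul_log_le_of_le_finestLevel {n j : ℕ} (hn : 3 ≤ n) (hj : j ≤ finestLevel n) :
    2 ^ j * log n ≤ n := by
  have hl : 0 < log n := one_pos.trans_le (one_le_log_natCast hn)
  have ratio : 1 ≤ n / log n := by
    rw [one_le_div hl]
    exact (log_le_sub_one_of_pos (by positivity)).trans (by linarith)
  have level : (j : ℝ) ≤ 1 / 2 * logb 2 (n / log n) :=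
    (Nat.cast_le.2 hj).trans
      (Nat.floor_le (mul_nonneg (by norm_num) (logb_nonneg one_lt_two ratio)))
  rw [← le_div_iff₀ hl, ← rpow_natCast, ← le_logb_iff_rpow_le one_lt_two (by positivity)]
  linarith [logb_nonneg one_lt_two ratio]

theorem two_pow_le_of_two_pow_mul_log_le {n j : ℕ} (hn : 3 ≤ n) (hj : 2 ^ j * log n ≤ n) :
    2 ^ j ≤ n :=
  mod_cast (le_mul_of_one_le_right (by positivity) (one_le_log_natCast hn)).trans hj

end BlockDeviation

section Regression

open Real
open scoped NNReal ENNReal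

theorem lintegral_exp_add_mul_gaussianReal (a b m : ℝ) (v : ℝ≥0) :
    ∫⁻ z, ENNReal.ofReal (exp (a + b * z)) ∂gaussianReal m v =
      ENNReal.ofReal (exp (a + (m * b + v * b ^ 2 / 2))) := by
  simp only [exp_add a, ENNReal.ofReal_mul (exp_pos a).le]
  rw [lintegral_const_mul _ (by fun_prop), ← ofReal_integral_eq_lintegral_ofReal
    (integrable_exp_mul_gaussianReal b) (.of_forall fun _ ↦ (exp_pos _).le)]
  exact congrArg (_ * ENNReal.ofReal ·) (congrFun mgf_id_gaussianReal b)

variable {Ω : Type*} [MeasurableSpace Ω] {P : Measure Ω}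

theorem lintegral_prod_map_pi {ι α : Type*} [Fintype ι] [MeasurableSpace α] {X : ι → Ω → α}
    (hX : ∀ i, Measurable (X i)) (hXi : iIndepFun X P) {G : ι → α → ℝ≥0∞}
    (hG : ∀ i, Measurable (G i)) :
    ∫⁻ x, ∏ i, G i (x i) ∂(P.map fun ω i ↦ X i ω) = ∏ i, ∫⁻ x, G i x ∂(P.map (X i)) := by
  rw [lintegral_map (by fun_prop) (measurable_pi_lambda _ hX)]
  simp only [lintegral_map (hG _) (hX _)]
  exact lintegral_prod_eq_prod_lintegral_of_indepFun Finset.univ (fun i ↦ G i ∘ X i)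
    (hXi.comp G hG) fun i ↦ (hG i).comp (hX i)

theorem lintegral_prod_eq_prod_lintegral_lintegral {ι α β : Type*} [Fintype ι]
    [MeasurableSpace α] [MeasurableSpace β] [IsFiniteMeasure P] {X : ι → Ω → α} {z : ι → Ω → β}
    (hX : ∀ i, Measurable (X i)) (hz : ∀ i, Measurable (z i)) (hXi : iIndepFun X P)
    (hzi : iIndepFun z P) (hXz : IndepFun (fun ω i ↦ X i ω) (fun ω i ↦ z i ω) P)
    {F : ι → α × β → ℝ≥0∞} (hF : ∀ i, Measurable (F i)) :
    ∫⁻ ω, ∏ i, F i (X i ω, z i ω) ∂P =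
      ∏ i, ∫⁻ x, ∫⁻ y, F i (x, y) ∂(P.map (z i)) ∂(P.map (X i)) := by
  have hXv : Measurable fun ω i ↦ X i ω := measurable_pi_lambda _ hX
  have hzv : Measurable fun ω i ↦ z i ω := measurable_pi_lambda _ hz
  calc ∫⁻ ω, ∏ i, F i (X i ω, z i ω) ∂P
      = ∫⁻ q, ∏ i, F i (q.1 i, q.2 i) ∂(P.map fun ω ↦ (fun i ↦ X i ω, fun i ↦ z i ω)) :=
        (lintegral_map (f := fun q : (ι → α) × (ι → β) ↦ ∏ i, F i (q.1 i, q.2 i))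
          (by fun_prop) (hXv.prodMk hzv)).symm
    _ = ∫⁻ x, ∫⁻ y, ∏ i, F i (x i, y i) ∂(P.map fun ω i ↦ z i ω) ∂(P.map fun ω i ↦ X i ω) := by
        rw [(indepFun_iff_map_prod_eq_prod_map_map hXv.aemeasurable hzv.aemeasurable).1 hXz,
          lintegral_prod _ (by fun_prop)]
    _ = ∫⁻ x, ∏ i, ∫⁻ y, F i (x i, y) ∂(P.map (z i)) ∂(P.map fun ω i ↦ X i ω) :=
        lintegral_congr fun x ↦
          lintegral_prod_map_pi hz hzi fun i ↦ (hF i).comp measurable_prodMk_left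
    _ = _ := lintegral_prod_map_pi hX hXi fun i ↦ (hF i).lintegral_prod_right'

theorem lintegral_exp_le_exp_integral {α : Type*} [MeasurableSpace α] {ν : Measure α}
    [IsProbabilityMeasure ν] {V h : α → ℝ} (hh : Integrable h ν)
    (hVh : ∀ᵐ x ∂ν, exp (V x) ≤ 1 + h x) :
    ∫⁻ x, ENNReal.ofReal (exp (V x)) ∂ν ≤ ENNReal.ofReal (exp (∫ x, h x ∂ν)) := by
  calc ∫⁻ x, ENNReal.ofReal (exp (V x)) ∂ν
      ≤ ∫⁻ x, ENNReal.ofReal (1 + h x) ∂ν :=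
        lintegral_mono_ae (hVh.mono fun _ hx ↦ ENNReal.ofReal_le_ofReal hx)
    _ = ENNReal.ofReal (∫ x, (1 + h x) ∂ν) :=
        (ofReal_integral_eq_lintegral_ofReal ((integrable_const 1).add hh)
          (hVh.mono fun _ hx ↦ (exp_pos _).le.trans hx)).symm
    _ = ENNReal.ofReal (∫ x, h x ∂ν + 1) := by
        rw [integral_add (integrable_const 1) hh, add_comm]; simp
    _ ≤ _ := ENNReal.ofReal_le_ofReal (add_one_le_exp _)

theorem exp_mul_add_half_sq_le {M a u : ℝ} (ha : |a| ≤ M) (hu : |u| ≤ 1 / (M + 1)) :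
    exp (a * u + u ^ 2 / 2) ≤ 1 + (a * u + (M + 1) ^ 2 * u ^ 2) := by
  have hM : 0 ≤ M := (abs_nonneg a).trans ha
  have hu' : (M + 1) * |u| ≤ 1 := by rwa [le_div_iff₀' (by positivity)] at hu
  have size : |a * u + u ^ 2 / 2| ≤ (M + 1 / 2) * |u| := by
    calc |a * u + u ^ 2 / 2| ≤ |a * u| + |u ^ 2 / 2| := abs_add_le _ _
      _ = |a| * |u| + |u| * |u| / 2 := by rw [abs_mul, abs_div, abs_pow, sq, abs_two]
      _ ≤ M * |u| + 1 * |u| / 2 := by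
          gcongr
          nlinarith [mul_nonneg hM (abs_nonneg u)]
      _ = (M + 1 / 2) * |u| := by ring
  have taylor := (abs_le.1 (abs_exp_sub_one_sub_id_le
    (size.trans (by nlinarith [abs_nonneg u])))).2
  have square := pow_le_pow_left₀ (abs_nonneg _) size 2
  rw [sq_abs, mul_pow, sq_abs] at square
  nlinarith [mul_nonneg hM (sq_nonneg u), sq_nonneg u]

theorem lintegral_exp_mul_add_half_sq_le {α : Type*} [MeasurableSpace α] {ν : Measure α}
    [IsProbabilityMeasure ν] {f u : α → ℝ} {M : ℝ} (hf : Measurable f) (hu : Measurable u)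
    (hfM : ∀ᵐ x ∂ν, |f x| ≤ M) (huM : ∀ᵐ x ∂ν, |u x| ≤ 1 / (M + 1)) :
    ∫⁻ x, ENNReal.ofReal (exp (f x * u x + u x ^ 2 / 2)) ∂ν ≤
      ENNReal.ofReal (exp (∫ x, f x * u x ∂ν + (M + 1) ^ 2 * ∫ x, u x ^ 2 ∂ν)) := by
  have integrable_u : Integrable u ν := .of_bound hu.aestronglyMeasurable _ huM
  have integrable_fu : Integrable (fun x ↦ f x * u x) ν :=
    integrable_u.bdd_mul hf.aestronglyMeasurable hfM
  have integrable_sq : Integrable (fun x ↦ u x ^ 2) ν := by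
    simp only [sq]
    exact integrable_u.bdd_mul hu.aestronglyMeasurable huM
  rw [← integral_const_mul, ← integral_add integrable_fu (integrable_sq.const_mul _)]
  exact lintegral_exp_le_exp_integral (integrable_fu.add (integrable_sq.const_mul _))
    (by filter_upwards [hfM, huM] with x using exp_mul_add_half_sq_le)

variable [IsProbabilityMeasure P] {f g : ℝ → ℝ} {n : ℕ} {X Y z : Fin n → Ω → ℝ}

theorem IsRandomDesignSample.lintegral_exp_sum_le (hs : IsRandomDesignSample P f g X Y z)
    {ν : Measure ℝ} (hν : ∀ i, P.map (X i) = ν) {u : ℝ → ℝ} {M : ℝ} (hf : Measurable f)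
    (hu : Measurable u) (hfM : ∀ᵐ x ∂ν, |f x| ≤ M) (huM : ∀ᵐ x ∂ν, |u x| ≤ 1 / (M + 1)) :
    ∫⁻ ω, ENNReal.ofReal (exp (∑ i, Y i ω * u (X i ω))) ∂P ≤
      ENNReal.ofReal (exp (n * (∫ x, f x * u x ∂ν + (M + 1) ^ 2 * ∫ x, u x ^ 2 ∂ν))) := by
  calc ∫⁻ ω, ENNReal.ofReal (exp (∑ i, Y i ω * u (X i ω))) ∂P
      = ∫⁻ ω, ∏ i, ENNReal.ofReal (exp (f (X i ω) * u (X i ω) + u (X i ω) * z i ω)) ∂P := by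
        refine lintegral_congr fun ω ↦ ?_
        rw [exp_sum, ENNReal.ofReal_prod_of_nonneg fun i _ ↦ (exp_pos _).le]
        simp only [hs.regression, add_mul, mul_comm (z _ ω)]
    _ = ∏ i : Fin n, ∫⁻ x, ∫⁻ y, ENNReal.ofReal (exp (f x * u x + u x * y))
          ∂(P.map (z i)) ∂(P.map (X i)) :=
        lintegral_prod_eq_prod_lintegral_lintegral hs.measurable_design hs.measurable_noise
          hs.indep_design hs.indep_noise hs.indep_design_noise
          (F := fun _ q ↦ ENNReal.ofReal (exp (f q.1 * u q.1 + u q.1 * q.2)))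
          fun _ ↦ by fun_prop
    _ = ∏ _i : Fin n, ∫⁻ x, ENNReal.ofReal (exp (f x * u x + u x ^ 2 / 2)) ∂ν := by
        simp only [hs.law_noise, hν, lintegral_exp_add_mul_gaussianReal, zero_mul, zero_add,
          NNReal.coe_one, one_mul]
    _ ≤ ∏ _i : Fin n, ENNReal.ofReal
          (exp (∫ x, f x * u x ∂ν + (M + 1) ^ 2 * ∫ x, u x ^ 2 ∂ν)) := by
        refine Finset.prod_le_prod' fun i _ ↦ ?_
        have : IsProbabilityMeasure ν :=
          hν i ▸ Measure.isProbabilityMeasure_map (hs.measurable_design i).aemeasurable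
        exact lintegral_exp_mul_add_half_sq_le hf hu hfM huM
    _ = _ := by
        rw [Finset.prod_const, Finset.card_univ, Fintype.card_fin,
          ← ENNReal.ofReal_pow (exp_pos _).le, exp_nat_mul]

end Regression

section EmpiricalError

open Real

/-- The error of the importance-weighted empirical mean `n⁻¹ ∑ yᵢ g(xᵢ)⁻¹ h(xᵢ)` as an estimator of
`∫₀¹ f h`. For `h = ψ^{per}_{j,k}` it is, by definition, `β̂_{j,k} - β_{j,k}`. -/
noncomputable def empiricalError (f g h : ℝ → ℝ) {n : ℕ} (x y : Fin n → ℝ) : ℝ :=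
  (n : ℝ)⁻¹ * ∑ i, y i * (g (x i))⁻¹ * h (x i) - ∫ x in Set.Icc (0 : ℝ) 1, f x * h x

theorem sum_mul_empiricalError {ι : Type*} [Fintype ι] {f g : ℝ → ℝ} {h : ι → ℝ → ℝ}
    (hfh : ∀ k, Integrable (fun x ↦ f x * h k x) (volume.restrict (Set.Icc (0 : ℝ) 1)))
    (t : ι → ℝ) {n : ℕ} (x y : Fin n → ℝ) :
    ∑ k, t k * empiricalError f g (h k) x y =
      empiricalError f g (fun x ↦ ∑ k, t k * h k x) x y := by
  have integral : ∫ x in Set.Icc (0 : ℝ) 1, f x * ∑ k, t k * h k x =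
      ∑ k, t k * ∫ x in Set.Icc (0 : ℝ) 1, f x * h k x := by
    simp only [Finset.mul_sum, mul_left_comm (f _), ← integral_const_mul]
    exact integral_finsetSum _ fun k _ ↦ (hfh k).const_mul _
  simp only [empiricalError, integral]
  simp only [mul_sub, Finset.sum_sub_distrib, Finset.mul_sum]
  rw [Finset.sum_comm]
  simp only [mul_left_comm (t _)]

theorem integral_withDensity_mul_inv {g F : ℝ → ℝ} {μ : Measure ℝ} (hg : Measurable g)
    (hg_pos : ∀ᵐ x ∂μ, 0 < g x) :
    ∫ x, F x * (g x)⁻¹ ∂μ.withDensity (fun x ↦ ENNReal.ofReal (g x)) = ∫ x, F x ∂μ := by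
  rw [integral_withDensity_eq_integral_toReal_smul (by fun_prop) (by simp)]
  refine integral_congr_ae ?_
  filter_upwards [hg_pos] with x hx
  rw [ENNReal.toReal_ofReal hx.le, smul_eq_mul]
  field_simp

theorem integral_withDensity_inv_mul_sq_le {g h : ℝ → ℝ} {μ : Measure ℝ} {c : ℝ} (hc : 0 < c)
    (hg : Measurable g) (hcg : ∀ᵐ x ∂μ, c ≤ g x) (hh : Integrable (fun x ↦ h x ^ 2) μ) :
    ∫ x, ((g x)⁻¹ * h x) ^ 2 ∂μ.withDensity (fun x ↦ ENNReal.ofReal (g x)) ≤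
      c⁻¹ * ∫ x, h x ^ 2 ∂μ := by
  calc _ = ∫ x, (g x)⁻¹ * h x ^ 2 ∂μ := by
        rw [← integral_withDensity_mul_inv hg (hcg.mono fun _ hx ↦ hc.trans_le hx)]
        refine integral_congr_ae (.of_forall fun x ↦ ?_)
        ring
    _ ≤ ∫ x, c⁻¹ * h x ^ 2 ∂μ := by
        refine integral_mono_of_nonneg ?_ (hh.const_mul _) ?_
        · filter_upwards [hcg] with x hx
          have := hc.trans_le hx
          positivity
        · filter_upwards [hcg] with x hx
          gcongr
    _ = _ := integral_const_mul _ _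

variable {Ω : Type*} [MeasurableSpace Ω] {P : Measure Ω} {f g : ℝ → ℝ} {n : ℕ}
  {X Y z : Fin n → Ω → ℝ}

theorem IsRandomDesignSample.measurable_empiricalError (hs : IsRandomDesignSample P f g X Y z)
    (hf : Measurable f) (hg : Measurable g) {h : ℝ → ℝ} (hh : Measurable h) :
    Measurable fun ω ↦ empiricalError f g h (fun i ↦ X i ω) (fun i ↦ Y i ω) := by
  have hX := hs.measurable_design
  have hz := hs.measurable_noise
  simp only [empiricalError, hs.regression]
  fun_prop

variable [IsProbabilityMeasure P] {M c : ℝ}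

theorem IsRandomDesignSample.lintegral_exp_mul_empiricalError_le
    (hs : IsRandomDesignSample P f g X Y z) (hn : 0 < n) (hc : 0 < c) (hf : Measurable f)
    (hg : Measurable g) (hfM : ∀ᵐ x ∂volume.restrict (Set.Icc (0 : ℝ) 1), |f x| ≤ M)
    (hcg : ∀ᵐ x ∂volume.restrict (Set.Icc (0 : ℝ) 1), c ≤ g x) {h : ℝ → ℝ} (hh : Measurable h)
    (hhM : ∀ᵐ x ∂volume.restrict (Set.Icc (0 : ℝ) 1), |h x| ≤ c / (M + 1)) :
    ∫⁻ ω, ENNReal.ofReal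
        (exp (n * empiricalError f g h (fun i ↦ X i ω) (fun i ↦ Y i ω))) ∂P ≤
      ENNReal.ofReal (exp (n * ((M + 1) ^ 2 / c * ∫ x in Set.Icc (0 : ℝ) 1, h x ^ 2))) := by
  set μ := volume.restrict (Set.Icc (0 : ℝ) 1)
  set ν := μ.withDensity fun x ↦ ENNReal.ofReal (g x)
  set u : ℝ → ℝ := fun x ↦ (g x)⁻¹ * h x with hu_def
  have hνμ : ν ≪ μ := withDensity_absolutelyContinuous μ _
  have bound_u : ∀ᵐ x ∂ν, |u x| ≤ 1 / (M + 1) := by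
    filter_upwards [hνμ hhM, hνμ hcg] with x hx hgx
    calc |u x| = (g x)⁻¹ * |h x| := by rw [hu_def, abs_mul, abs_inv, abs_of_pos (hc.trans_le hgx)]
      _ ≤ c⁻¹ * (c / (M + 1)) := by gcongr
      _ = 1 / (M + 1) := by field_simp
  have mean : ∫ x, f x * u x ∂ν = ∫ x, f x * h x ∂μ := by
    rw [← integral_withDensity_mul_inv hg (hcg.mono fun _ hx ↦ hc.trans_le hx)]
    simp only [hu_def, mul_assoc, mul_comm (h _)]
    rfl
  have variance : ∫ x, u x ^ 2 ∂ν ≤ c⁻¹ * ∫ x, h x ^ 2 ∂μ := by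
    refine integral_withDensity_inv_mul_sq_le hc hg hcg ?_
    simp only [sq (h _)]
    exact (Integrable.of_bound hh.aestronglyMeasurable _ hhM).bdd_mul hh.aestronglyMeasurable hhM
  calc _ = ∫⁻ ω, ENNReal.ofReal (exp (∑ i, Y i ω * u (X i ω))) *
          ENNReal.ofReal (exp (-(n * ∫ x, f x * h x ∂μ))) ∂P := by
        refine lintegral_congr fun ω ↦ ?_
        rw [← ENNReal.ofReal_mul (exp_pos _).le, ← exp_add, empiricalError, mul_sub,
          mul_inv_cancel_left₀ (by positivity), ← sub_eq_add_neg]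
        simp only [hu_def, mul_assoc]
        rfl
    _ ≤ ENNReal.ofReal (exp (n * (∫ x, f x * u x ∂ν + (M + 1) ^ 2 * ∫ x, u x ^ 2 ∂ν))) *
          ENNReal.ofReal (exp (-(n * ∫ x, f x * h x ∂μ))) := by
        rw [lintegral_mul_const' _ _ ENNReal.ofReal_ne_top]
        gcongr
        exact hs.lintegral_exp_sum_le hs.law_design hf (by fun_prop) (hνμ hfM) bound_u
    _ ≤ _ := by
        rw [← ENNReal.ofReal_mul (exp_pos _).le, ← exp_add, mean, ← mul_neg, ← mul_add,
          div_eq_mul_inv, mul_assoc]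
        gcongr
        linarith [mul_le_mul_of_nonneg_left variance (sq_nonneg (M + 1))]

theorem IsRandomDesignSample.hasJointSubgaussianMGF (hs : IsRandomDesignSample P f g X Y z)
    {ι : Type*} [Fintype ι] (hn : 0 < n) (hc : 0 < c) (hf : Measurable f) (hg : Measurable g)
    (hfM : ∀ᵐ x ∂volume.restrict (Set.Icc (0 : ℝ) 1), |f x| ≤ M)
    (hcg : ∀ᵐ x ∂volume.restrict (Set.Icc (0 : ℝ) 1), c ≤ g x) {h : ι → ℝ → ℝ}
    (hh : ∀ k, Measurable (h k))
    (hhi : ∀ k, Integrable (h k) (volume.restrict (Set.Icc (0 : ℝ) 1))) {T v : ℝ}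
    (hT : ∀ x, T * ∑ k, |h k x| ≤ c * √n / (M + 1))
    (hv : ∀ t : ι → ℝ, (M + 1) ^ 2 / c * ∫ x in Set.Icc (0 : ℝ) 1, (∑ k, t k * h k x) ^ 2 ≤
      v * (∑ k, t k ^ 2) / 2) :
    HasJointSubgaussianMGF
      (fun k ω ↦ √n * empiricalError f g (h k) (fun i ↦ X i ω) (fun i ↦ Y i ω)) v T P := by
  intro t ht
  have hsn : 0 < √(n : ℝ) := by positivity
  have hfh (k : ι) : Integrable (fun x ↦ f x * h k x) (volume.restrict (Set.Icc (0 : ℝ) 1)) :=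
    (hhi k).bdd_mul hf.aestronglyMeasurable hfM
  have linear (ω : Ω) :
      ∑ k, t k * (√n * empiricalError f g (h k) (fun i ↦ X i ω) (fun i ↦ Y i ω)) =
        n * empiricalError f g (fun x ↦ (√n)⁻¹ * ∑ k, t k * h k x) (fun i ↦ X i ω)
          (fun i ↦ Y i ω) := by
    simp only [Finset.mul_sum, ← mul_assoc]
    rw [← sum_mul_empiricalError hfh, Finset.mul_sum]
    refine Finset.sum_congr rfl fun k _ ↦ ?_
    nth_rw 2 [← mul_self_sqrt n.cast_nonneg]
    field_simp
  have bound (x : ℝ) : |(√n)⁻¹ * ∑ k, t k * h k x| ≤ c / (M + 1) := by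
    calc |(√n)⁻¹ * ∑ k, t k * h k x| ≤ (√n)⁻¹ * ∑ k, |t k| * |h k x| := by
          rw [abs_mul, abs_of_pos (inv_pos.2 hsn)]
          gcongr
          simpa only [abs_mul] using
            Finset.abs_sum_le_sum_abs (fun k ↦ t k * h k x) Finset.univ
      _ ≤ (√n)⁻¹ * (T * ∑ k, |h k x|) := by
          rw [Finset.mul_sum _ _ T]
          gcongr with k
          exact ht k
      _ ≤ (√n)⁻¹ * (c * √n / (M + 1)) := by gcongr; exact hT x
      _ = c / (M + 1) := by field_simp
  simp only [linear]
  refine (hs.lintegral_exp_mul_empiricalError_le hn hc hf hg hfM hcg (by fun_prop)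
    (.of_forall bound)).trans (ENNReal.ofReal_le_ofReal (exp_le_exp.2 ?_))
  refine le_trans (le_of_eq ?_) (hv t)
  simp only [mul_pow, inv_pow, sq_sqrt n.cast_nonneg, integral_const_mul]
  field_simp

end EmpiricalError

section Periodization

open Real
open scoped ENNReal

theorem lintegral_Icc_tsum_sub_intCast {F : ℝ → ℝ≥0∞} (hF : Measurable F) :
    ∫⁻ x in Set.Icc (0 : ℝ) 1, ∑' l : ℤ, F (x - l) = ∫⁻ x, F x := by
  have cell (l : ℤ) : ∫⁻ x in Set.Ico (0 : ℝ) 1, F (x - l) =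
      ∫⁻ x in Set.Ico ((-l : ℤ) : ℝ) ((-l : ℤ) + 1), F x := by
    rw [← (measurePreserving_sub_right volume (l : ℝ)).setLIntegral_comp_preimage
      measurableSet_Ico hF]
    congr
    ext x
    simp [add_comm]
  rw [← restrict_Ico_eq_restrict_Icc, lintegral_tsum fun l ↦ by fun_prop]
  simp only [cell]
  have reflect := (Equiv.neg ℤ).tsum_eq fun l : ℤ ↦ ∫⁻ x in Set.Ico (l : ℝ) (l + 1), F x
  simp only [Equiv.neg_apply] at reflect
  rw [reflect, ← lintegral_iUnion (fun _ ↦ measurableSet_Ico) (Set.pairwise_disjoint_Ico_intCast ℝ),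
    iUnion_Ico_intCast, Measure.restrict_univ]

theorem lintegral_comp_mul_left {F : ℝ → ℝ≥0∞} (hF : Measurable F) {a : ℝ} (ha : a ≠ 0) :
    ENNReal.ofReal |a| * ∫⁻ x, F (a * x) = ∫⁻ x, F x := by
  conv_rhs => rw [← Real.smul_map_volume_mul_left ha, lintegral_smul_measure, smul_eq_mul,
    lintegral_map hF (by fun_prop)]

variable {ψ : ℝ → ℝ}

@[fun_prop]
theorem measurable_dilate (hψ : Measurable ψ) (j : ℕ) (k : ℤ) : Measurable (dilate ψ j k) := by
  unfold dilate
  fun_prop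

theorem measurable_periodized (hψ : Measurable ψ) (j k : ℕ) : Measurable (periodized ψ j k) :=
  Measurable.tsum fun l ↦ by fun_prop

theorem enorm_dilate (ψ : ℝ → ℝ) (j : ℕ) (k : ℤ) (x : ℝ) :
    ‖dilate ψ j k x‖ₑ = ENNReal.ofReal ((2 : ℝ) ^ ((j : ℝ) / 2)) * ‖ψ (2 ^ j * x - k)‖ₑ := by
  rw [dilate, enorm_mul, enorm_eq_ofReal (by positivity)]

theorem dilate_sub_intCast (ψ : ℝ → ℝ) (j : ℕ) (k l : ℤ) (x : ℝ) :
    dilate ψ j k (x - l) = dilate ψ j (l * 2 ^ j + k) x := by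
  simp only [dilate]
  push_cast
  ring_nf

theorem lintegral_enorm_dilate (hψ : Measurable ψ) (j : ℕ) (k : ℤ) :
    ∫⁻ x, ‖dilate ψ j k x‖ₑ =
      ENNReal.ofReal ((2 : ℝ) ^ (-((j : ℝ) / 2))) * ∫⁻ y, ‖ψ y‖ₑ := by
  have factor : ENNReal.ofReal ((2 : ℝ) ^ ((j : ℝ) / 2)) =
      ENNReal.ofReal ((2 : ℝ) ^ (-((j : ℝ) / 2))) * ENNReal.ofReal |2 ^ j| := by
    rw [← ENNReal.ofReal_mul (by positivity), abs_of_pos (by positivity), ← rpow_natCast,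
      ← rpow_add two_pos]
    ring_nf
  simp only [enorm_dilate]
  rw [lintegral_const_mul _ (by fun_prop), factor, mul_assoc,
    lintegral_comp_mul_left (F := fun y ↦ ‖ψ (y - k)‖ₑ) (by fun_prop) (by positivity),
    lintegral_sub_right_eq_self fun y ↦ ‖ψ y‖ₑ]

theorem enorm_periodized_le (ψ : ℝ → ℝ) (j k : ℕ) (x : ℝ) :
    ‖periodized ψ j k x‖ₑ ≤ ∑' l : ℤ, ‖dilate ψ j k (x - l)‖ₑ :=
  enorm_tsum_le_tsum_enorm

theorem sum_enorm_periodized_le (ψ : ℝ → ℝ) (j : ℕ) (x : ℝ) :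
    ∑ k ∈ Finset.range (2 ^ j), ‖periodized ψ j k x‖ₑ ≤ ∑' m : ℤ, ‖dilate ψ j m x‖ₑ := by
  calc _ ≤ ∑ k ∈ Finset.range (2 ^ j), ∑' l : ℤ, ‖dilate ψ j k (x - l)‖ₑ :=
        Finset.sum_le_sum fun k _ ↦ enorm_periodized_le ψ j k x
    _ = ∑' l : ℤ, ∑' k : Fin (2 ^ j), ‖dilate ψ j (l * 2 ^ j + k) x‖ₑ := by
        rw [ENNReal.tsum_comm, tsum_fintype, Finset.sum_range]
        simp only [dilate_sub_intCast]
    _ = ∑' m : ℤ, ‖dilate ψ j m x‖ₑ := by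
        rw [← ENNReal.tsum_prod, ← (Int.divModEquiv (2 ^ j)).symm.tsum_eq]
        simp

variable {R : ℝ}

theorem sum_abs_periodized_le (hψR : ∀ y, ∑' m : ℤ, ‖ψ (y - m)‖ₑ ≤ ENNReal.ofReal R) (hR : 0 ≤ R)
    (j : ℕ) (x : ℝ) :
    ∑ k ∈ Finset.range (2 ^ j), |periodized ψ j k x| ≤ 2 ^ ((j : ℝ) / 2) * R := by
  rw [← ENNReal.ofReal_le_ofReal_iff (by positivity),
    ENNReal.ofReal_sum_of_nonneg fun _ _ ↦ abs_nonneg _, ENNReal.ofReal_mul (by positivity)]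
  simp only [← enorm_eq_ofReal_abs]
  refine (sum_enorm_periodized_le ψ j x).trans ?_
  simp only [enorm_dilate, ENNReal.tsum_mul_left]
  gcongr
  exact hψR _

theorem lintegral_enorm_periodized_le (hψ : Measurable ψ)
    (hψR : ∀ y, ∑' m : ℤ, ‖ψ (y - m)‖ₑ ≤ ENNReal.ofReal R) (j k : ℕ) :
    ∫⁻ x in Set.Icc (0 : ℝ) 1, ‖periodized ψ j k x‖ₑ ≤
      ENNReal.ofReal (2 ^ (-((j : ℝ) / 2)) * R) := by
  have mother : ∫⁻ y, ‖ψ y‖ₑ ≤ ENNReal.ofReal R := by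
    calc _ = ∫⁻ x in Set.Icc (0 : ℝ) 1, ∑' l : ℤ, ‖ψ (x - l)‖ₑ :=
          (lintegral_Icc_tsum_sub_intCast hψ.enorm).symm
      _ ≤ ∫⁻ _ in Set.Icc (0 : ℝ) 1, ENNReal.ofReal R := lintegral_mono fun x ↦ hψR x
      _ = ENNReal.ofReal R := by simp
  calc _ ≤ ∫⁻ x in Set.Icc (0 : ℝ) 1, ∑' l : ℤ, ‖dilate ψ j k (x - l)‖ₑ :=
        lintegral_mono fun x ↦ enorm_periodized_le ψ j k x
    _ = ENNReal.ofReal (2 ^ (-((j : ℝ) / 2))) * ∫⁻ y, ‖ψ y‖ₑ := by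
        rw [lintegral_Icc_tsum_sub_intCast (measurable_dilate hψ j k).enorm,
          lintegral_enorm_dilate hψ]
    _ ≤ _ := by
        rw [ENNReal.ofReal_mul (by positivity)]
        gcongr

theorem integrableOn_periodized (hψ : Measurable ψ)
    (hψR : ∀ y, ∑' m : ℤ, ‖ψ (y - m)‖ₑ ≤ ENNReal.ofReal R) (j k : ℕ) :
    IntegrableOn (periodized ψ j k) (Set.Icc 0 1) :=
  ⟨(measurable_periodized hψ j k).aestronglyMeasurable,
    (lintegral_enorm_periodized_le hψ hψR j k).trans_lt ENNReal.ofReal_lt_top⟩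

theorem integral_abs_periodized_le (hψ : Measurable ψ)
    (hψR : ∀ y, ∑' m : ℤ, ‖ψ (y - m)‖ₑ ≤ ENNReal.ofReal R) (hR : 0 ≤ R) (j k : ℕ) :
    ∫ x in Set.Icc (0 : ℝ) 1, |periodized ψ j k x| ≤ 2 ^ (-((j : ℝ) / 2)) * R := by
  simp only [← norm_eq_abs]
  rw [integral_norm_eq_lintegral_enorm (measurable_periodized hψ j k).aestronglyMeasurable]
  exact ENNReal.toReal_le_of_le_ofReal (by positivity) (lintegral_enorm_periodized_le hψ hψR j k)

/-- A form of Schur's test. -/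
theorem integral_sum_mul_sq_le {α ι : Type*} [MeasurableSpace α] [Fintype ι] {μ : Measure α}
    {h : ι → α → ℝ} {A D : ℝ} (hA : ∀ x, ∑ k, |h k x| ≤ A) (hh : ∀ k, Integrable (h k) μ)
    (hD : ∀ k, ∫ x, |h k x| ∂μ ≤ D) (hA₀ : 0 ≤ A) (t : ι → ℝ) :
    ∫ x, (∑ k, t k * h k x) ^ 2 ∂μ ≤ A * D * ∑ k, t k ^ 2 := by
  have cauchy_schwarz (x : α) : (∑ k, t k * h k x) ^ 2 ≤ A * ∑ k, t k ^ 2 * |h k x| := by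
    refine (Finset.sum_sq_le_sum_mul_sum_of_sq_le_mul Finset.univ (f := fun k ↦ |h k x|)
      (g := fun k ↦ t k ^ 2 * |h k x|) (fun k _ ↦ abs_nonneg _) (fun k _ ↦ by positivity)
      fun k _ ↦ le_of_eq ?_).trans ?_
    · rw [mul_pow, ← sq_abs (h k x)]
      ring
    · gcongr
      exact hA x
  have hi (k : ι) : Integrable (fun x ↦ t k ^ 2 * |h k x|) μ := (hh k).abs.const_mul _
  calc ∫ x, (∑ k, t k * h k x) ^ 2 ∂μ ≤ ∫ x, A * ∑ k, t k ^ 2 * |h k x| ∂μ :=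
        integral_mono_of_nonneg (.of_forall fun x ↦ sq_nonneg _)
          ((integrable_finsetSum _ fun k _ ↦ hi k).const_mul _) (.of_forall cauchy_schwarz)
    _ = A * ∑ k, t k ^ 2 * ∫ x, |h k x| ∂μ := by
        rw [integral_const_mul, integral_finsetSum _ fun k _ ↦ hi k]
        simp only [integral_const_mul]
    _ ≤ A * ∑ k, t k ^ 2 * D := by
        gcongr with k
        exact hD k
    _ = A * D * ∑ k, t k ^ 2 := by rw [← Finset.sum_mul]; ring

theorem tsum_enorm_sub_intCast_le {S B : ℝ} (hB : ∀ y, |ψ y| ≤ B) (hS₀ : 0 ≤ S)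
    (hS : ∀ y, S ≤ |y| → ψ y = 0) (y : ℝ) :
    ∑' m : ℤ, ‖ψ (y - m)‖ₑ ≤ ENNReal.ofReal ((2 * S + 1) * B) := by
  have outside (m : ℤ) (hm : m ∉ Finset.Icc ⌈y - S⌉ ⌊y + S⌋) : ‖ψ (y - m)‖ₑ = 0 := by
    rw [enorm_eq_zero]
    refine hS _ (le_of_not_ge fun hle ↦ hm ?_)
    rw [abs_le] at hle
    rw [Finset.mem_Icc, Int.ceil_le, Int.le_floor]
    constructor <;> linarith
  have count : ((Finset.Icc ⌈y - S⌉ ⌊y + S⌋).card : ℝ) ≤ 2 * S + 1 := by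
    rw [Int.card_Icc, ← Int.cast_natCast, Int.toNat_eq_max, Int.cast_max, max_le_iff]
    push_cast
    constructor <;> linarith [Int.floor_le (y + S), Int.le_ceil (y - S)]
  calc _ = ∑ m ∈ Finset.Icc ⌈y - S⌉ ⌊y + S⌋, ‖ψ (y - m)‖ₑ := tsum_eq_sum outside
    _ ≤ ∑ _ ∈ Finset.Icc ⌈y - S⌉ ⌊y + S⌋, ENNReal.ofReal B := by
        gcongr with m
        rw [enorm_eq_ofReal_abs]
        exact ENNReal.ofReal_le_ofReal (hB _)
    _ ≤ ENNReal.ofReal ((2 * S + 1) * B) := by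
        rw [Finset.sum_const, nsmul_eq_mul, ← ENNReal.ofReal_natCast,
          ← ENNReal.ofReal_mul (by positivity)]
        have : 0 ≤ B := (abs_nonneg _).trans (hB 0)
        gcongr

theorem exists_tsum_enorm_sub_intCast_le (hψ : HasCompactSupport ψ)
    (hB : ∃ B : ℝ, ∀ y, |ψ y| ≤ B) :
    ∃ R : ℝ, 0 < R ∧ ∀ y, ∑' m : ℤ, ‖ψ (y - m)‖ₑ ≤ ENNReal.ofReal R := by
  obtain ⟨B, hB⟩ := hB
  obtain ⟨S, hS₀, hS⟩ := hψ.exists_pos_le_norm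
  have overlap := tsum_enorm_sub_intCast_le hB hS₀.le hS
  exact ⟨max ((2 * S + 1) * B) 1, by positivity, fun y ↦
    (overlap y).trans (ENNReal.ofReal_le_ofReal (le_max_left _ _))⟩

end Periodization

section WaveletCoefficients

open Real

variable {Ω : Type*} [MeasurableSpace Ω] {P : Measure Ω} {n : ℕ} {p v : ℝ}

/-- The constant in the bound `O(n⁻ᵖ)` on the absolute moment of order `2p`: the value at radius
`t = √(2 (p + 1) / v)` of the bound `2 (q / t) ^ q exp (v t ^ 2 / 2)` for the moment of order
`q = 2p` of a variable with variance proxy `v`. -/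
noncomputable def momentBound (p v : ℝ) : ℝ :=
  2 * (2 * p / √(2 * (p + 1) / v)) ^ (2 * p) * exp (p + 1)

theorem momentBound_pos (hp : 0 < p) (hv : 0 < v) : 0 < momentBound p v := by
  unfold momentBound
  positivity

theorem HasJointSubgaussianMGF.integrable_and_integral_abs_rpow_le {ι : Type*} [Fintype ι]
    {e : ι → Ω → ℝ}
    (h : HasJointSubgaussianMGF (fun k ω ↦ √n * e k ω) v √(2 * (p + 1) * log n / v) P)
    (he : ∀ k, Measurable (e k)) (hp : 0 ≤ p) (hv : 0 < v) (hn : 3 ≤ n) (k : ι) :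
    Integrable (fun ω ↦ |e k ω| ^ (2 * p)) P ∧
      ∫ ω, |e k ω| ^ (2 * p) ∂P ≤ momentBound p v * (n : ℝ) ^ (-p) := by
  have le_radius : √(2 * (p + 1) / v) ≤ √(2 * (p + 1) * log n / v) := by
    gcongr √(?_ / v)
    exact le_mul_of_one_le_right (by positivity) (one_le_log_natCast hn)
  obtain ⟨integrable, moment⟩ := h.integrable_and_integral_rpow_le (fun k ↦ (he k).const_mul _) k
    (q := 2 * p) (by positivity) (by positivity) le_radius
  simp only [abs_rpow_two_mul_eq (mod_cast (by lia : 0 < n) : (0 : ℝ) < n) (e k _)]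
  refine ⟨integrable.const_mul _, ?_⟩
  rw [integral_const_mul, mul_comm (momentBound p v)]
  gcongr
  refine moment.trans_eq ?_
  rw [momentBound, sq_sqrt (by positivity)]
  field_simp

theorem HasJointSubgaussianMGF.measureReal_le_rpow_inv_le [IsFiniteMeasure P]
    {ι : Type*} [Fintype ι] {e : ι → Ω → ℝ}
    (h : HasJointSubgaussianMGF (fun k ω ↦ √n * e k ω) v √(2 * (p + 1) * log n / v) P)
    (he : ∀ k, Measurable (e k)) (hp : 2 ≤ p) (hv : 0 < v) (hn : 3 ≤ n)
    (hL : Fintype.card ι ≤ blockLength p n) (hcard : Fintype.card ι ≤ n) :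
    P.real {ω | deviationConst p v ^ (1 / p) * (n : ℝ) ^ (-(1 / 2) : ℝ) ≤
      ((blockLength p n : ℝ)⁻¹ * ∑ k, |e k ω| ^ p) ^ (1 / p)} ≤ 3 * (n : ℝ) ^ (-p) := by
  have hp₀ : 0 < p := by linarith
  have hD := deviationConst_pos hp₀ hv
  have hlog := one_pos.trans_le (one_le_log_natCast hn)
  have hL₀ : (0 : ℝ) < blockLength p n :=
    lt_of_lt_of_le (by positivity) (half_rpow_log_le_blockLength hp₀.le hn)
  refine ENNReal.toReal_le_of_le_ofReal (by positivity) ((measure_mono fun ω hω ↦ ?_).trans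
    (h.measure_blockLength_mul_le_sum_rpow_le (fun k ↦ (he k).const_mul _) hp hv hn hL hcard))
  have := mul_rpow_le_sum_of_le_rpow_inv (by positivity) hL₀ hp₀ (by positivity) hω
  rwa [one_div, rpow_inv_rpow hD.le hp₀.ne'] at this

/-- The variance proxy of the normalized errors `√n (β̂_{j,k} - β_{j,k})`. The first term is what
their log-MGF requires; the second makes the cube on which the log-MGF bound is needed admissible
at every level `j` with `2 ^ j * log n ≤ n`. -/
noncomputable def varianceProxy (p R M c : ℝ) : ℝ :=
  2 * (M + 1) ^ 2 * R ^ 2 / c + 2 * (M + 1) ^ 2 * R ^ 2 * (p + 1) / c ^ 2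

variable {R M c : ℝ}

theorem varianceProxy_pos (hp : 0 ≤ p) (hR : 0 < R) (hM : 0 ≤ M) (hc : 0 < c) :
    0 < varianceProxy p R M c := by
  unfold varianceProxy
  positivity

theorem sqrt_mul_two_rpow_half_mul_le {j : ℕ} (hp : 0 ≤ p) (hR : 0 < R) (hM : 0 ≤ M) (hc : 0 < c)
    (hj : 2 ^ j * log n ≤ n) :
    √(2 * (p + 1) * log n / varianceProxy p R M c) * (2 ^ ((j : ℝ) / 2) * R) ≤
      c * √n / (M + 1) := by
  have hv := varianceProxy_pos hp hR hM hc
  have proxy_ge : 2 * (M + 1) ^ 2 * R ^ 2 * (p + 1) / c ^ 2 ≤ varianceProxy p R M c :=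
    le_add_of_nonneg_left (by positivity)
  have two_pow : ((2 : ℝ) ^ ((j : ℝ) / 2)) ^ 2 = 2 ^ j := by
    rw [← rpow_mul_natCast two_pos.le, ← rpow_natCast]
    simp
  refine (sq_le_sq₀ (by positivity) (by positivity)).1 ?_
  calc _ = 2 * (p + 1) * log n / varianceProxy p R M c * (2 ^ j * R ^ 2) := by
        rw [mul_pow, mul_pow, sq_sqrt (by positivity), two_pow]
    _ ≤ 2 * (p + 1) * log n / (2 * (M + 1) ^ 2 * R ^ 2 * (p + 1) / c ^ 2) * (2 ^ j * R ^ 2) := by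
        gcongr
    _ = c ^ 2 * (2 ^ j * log n) / (M + 1) ^ 2 := by field_simp
    _ ≤ c ^ 2 * n / (M + 1) ^ 2 := by gcongr
    _ = (c * √n / (M + 1)) ^ 2 := by rw [div_pow, mul_pow, sq_sqrt n.cast_nonneg]

theorem IsRandomDesignSample.hasJointSubgaussianMGF_periodized [IsProbabilityMeasure P]
    {ψ f g : ℝ → ℝ} {X Y z : Fin n → Ω → ℝ} (hs : IsRandomDesignSample P f g X Y z) (hn : 0 < n)
    (hM : 0 ≤ M) (hc : 0 < c) (hf : Measurable f) (hg : Measurable g)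
    (hfM : ∀ᵐ x ∂volume.restrict (Set.Icc (0 : ℝ) 1), |f x| ≤ M)
    (hcg : ∀ᵐ x ∂volume.restrict (Set.Icc (0 : ℝ) 1), c ≤ g x) (hψ : Measurable ψ)
    (hψR : ∀ y, ∑' m : ℤ, ‖ψ (y - m)‖ₑ ≤ ENNReal.ofReal R) (hR : 0 < R) (hp : 0 ≤ p) {j : ℕ}
    {s : Finset ℕ} (hsj : s ⊆ Finset.range (2 ^ j)) (hj : 2 ^ j * log n ≤ n) :
    HasJointSubgaussianMGF (fun (k : s) ω ↦ √n *
        empiricalError f g (periodized ψ j k) (fun i ↦ X i ω) (fun i ↦ Y i ω))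
      (varianceProxy p R M c) √(2 * (p + 1) * log n / varianceProxy p R M c) P := by
  have overlap (x : ℝ) : ∑ k : s, |periodized ψ j k x| ≤ 2 ^ ((j : ℝ) / 2) * R := by
    rw [Finset.sum_coe_sort s fun k ↦ |periodized ψ j k x|]
    exact (Finset.sum_le_sum_of_subset_of_nonneg hsj fun _ _ _ ↦ abs_nonneg _).trans
      (sum_abs_periodized_le hψR hR.le j x)
  refine hs.hasJointSubgaussianMGF hn hc hf hg hfM hcg
    (h := fun k : s ↦ periodized ψ j k) (fun k ↦ measurable_periodized hψ j k)
    (fun k ↦ integrableOn_periodized hψ hψR j k)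
    (fun x ↦ (mul_le_mul_of_nonneg_left (overlap x) (sqrt_nonneg _)).trans
      (sqrt_mul_two_rpow_half_mul_le hp hR hM hc hj)) fun t ↦ ?_
  have schur := integral_sum_mul_sq_le overlap (fun k ↦ integrableOn_periodized hψ hψR j k)
    (fun k ↦ integral_abs_periodized_le hψ hψR hR.le j k) (by positivity) t
  have proxy_ge : 2 * (M + 1) ^ 2 * R ^ 2 / c ≤ varianceProxy p R M c :=
    le_add_of_nonneg_right (by positivity)
  calc _ ≤ (M + 1) ^ 2 / c *
        (2 ^ ((j : ℝ) / 2) * R * (2 ^ (-((j : ℝ) / 2)) * R) * ∑ k, t k ^ 2) := by gcongr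
    _ = 2 * (M + 1) ^ 2 * R ^ 2 / c * (∑ k, t k ^ 2) / 2 := by
        rw [rpow_neg two_pos.le]
        field_simp
    _ ≤ _ := by gcongr

end WaveletCoefficients

end WaveletRegression

open WaveletRegression in
theorem proposition4p1_general (p : ℝ) (hp : 2 ≤ p) (R : ℝ) (hR : 0 < R) (M : ℝ) (hM : 0 ≤ M)
    (c : ℝ) (hc : 0 < c) :
    ∃ μ₁ C : ℝ, 0 < μ₁ ∧ 0 < C ∧ ∀ ψ : ℝ → ℝ, Measurable ψ →
      (∀ y, ∑' m : ℤ, ‖ψ (y - m)‖ₑ ≤ ENNReal.ofReal R) →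
      ∀ n : ℕ, 3 ≤ n → ∀ f : ℝ → ℝ, Measurable f →
      (∀ᵐ x ∂(volume.restrict (Set.Icc (0 : ℝ) 1)), |f x| ≤ M) →
      ∀ g : ℝ → ℝ, Measurable g → (∀ᵐ x ∂(volume.restrict (Set.Icc (0 : ℝ) 1)), c ≤ g x) →
      ∀ (Ω : Type*) [MeasurableSpace Ω] (P : Measure Ω) [IsProbabilityMeasure P]
        (X Y z : Fin n → Ω → ℝ), IsRandomDesignSample P f g X Y z →
      ∀ j : ℕ, 2 ^ j * Real.log n ≤ n →
        (∀ k ∈ Finset.range (2 ^ j),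
          Integrable (fun ω => |empiricalCoeff ψ g (fun i => X i ω) (fun i => Y i ω) j k
            - waveletCoeff ψ f j k| ^ (2 * p)) P ∧
          ∫ ω, |empiricalCoeff ψ g (fun i => X i ω) (fun i => Y i ω) j k
            - waveletCoeff ψ f j k| ^ (2 * p) ∂P ≤ C * (n : ℝ) ^ (-p)) ∧
        (∀ s ⊆ Finset.range (2 ^ j), s.card ≤ blockLength p n →
          P.real {ω | μ₁ * 2⁻¹ * (n : ℝ) ^ (-(1 / 2) : ℝ) ≤ ((blockLength p n : ℝ)⁻¹ *
            ∑ k ∈ s, |empiricalCoeff ψ g (fun i => X i ω) (fun i => Y i ω) j k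
              - waveletCoeff ψ f j k| ^ p) ^ (1 / p)} ≤ 3 * (n : ℝ) ^ (-p)) := by
  have hp₀ : 0 < p := by linarith
  have hv := varianceProxy_pos hp₀.le hR hM hc
  refine ⟨deviationConst p (varianceProxy p R M c) ^ (1 / p) * 2,
    momentBound p (varianceProxy p R M c),
    mul_pos (Real.rpow_pos_of_pos (deviationConst_pos hp₀ hv) _) two_pos, momentBound_pos hp₀ hv,
    fun ψ hψ hψR n hn f hf hfM g hg hcg Ω _ P _ X Y z hs j hj ↦ ?_⟩
  have subgaussian {s : Finset ℕ} (hsj : s ⊆ Finset.range (2 ^ j)) :=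
    hs.hasJointSubgaussianMGF_periodized (by lia) hM hc hf hg hfM hcg hψ hψR hR hp₀.le hsj hj
  have measurable (k : ℕ) := hs.measurable_empiricalError hf hg (measurable_periodized hψ j k)
  refine ⟨fun k hk ↦ (subgaussian subset_rfl).integrable_and_integral_abs_rpow_le
    (fun k ↦ measurable k) hp₀.le hv hn ⟨k, hk⟩, fun s hsj hL ↦ ?_⟩
  have card_le : s.card ≤ n := by
    simpa using (Finset.card_le_card hsj).trans
      ((Finset.card_range _).trans_le (two_pow_le_of_two_pow_mul_log_le hn hj))
  have deviation := (subgaussian hsj).measureReal_le_rpow_inv_le (fun k ↦ measurable k) hp hv hn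
    (by simpa) (by simpa)
  simp only [mul_inv_cancel_right₀ (two_ne_zero (α := ℝ)), ← Finset.sum_coe_sort s]
  exact deviation

theorem proposition4p1 (φ ψ : ℝ → ℝ) (hw : WaveletRegression.IsWaveletPair φ ψ)
    (p : ℝ) (hp : 2 ≤ p) (M' : ℝ) (hM' : 0 < M') (c G : ℝ) (hc : 0 < c) :
    ∃ μ₁ C : ℝ, 0 < μ₁ ∧ 0 < C ∧ ∃ N : ℕ, ∀ n : ℕ, N ≤ n →
      ∀ f : ℝ → ℝ, Measurable f →
      (∀ᵐ x ∂(volume.restrict (Set.Icc (0 : ℝ) 1)), |f x| ≤ M') →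
      ∀ g : ℝ → ℝ, Measurable g →
      (∀ᵐ x ∂(volume.restrict (Set.Icc (0 : ℝ) 1)), c ≤ g x ∧ g x ≤ G) →
      ∀ (Ω : Type*) [MeasurableSpace Ω] (P : Measure Ω) [IsProbabilityMeasure P]
        (X Y z : Fin n → Ω → ℝ), WaveletRegression.IsRandomDesignSample P f g X Y z →
      ∀ j : ℕ, WaveletRegression.coarsestLevel p n ≤ j → j ≤ WaveletRegression.finestLevel n →
        (∀ k ∈ Finset.range (2 ^ j),
          Integrable (fun ω =>
            |WaveletRegression.empiricalCoeff ψ g (fun i => X i ω) (fun i => Y i ω) j k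
              - WaveletRegression.waveletCoeff ψ f j k| ^ (2 * p)) P ∧
          ∫ ω, |WaveletRegression.empiricalCoeff ψ g (fun i => X i ω) (fun i => Y i ω) j k
              - WaveletRegression.waveletCoeff ψ f j k| ^ (2 * p) ∂P ≤ C * (n : ℝ) ^ (-p)) ∧
        (∀ K ∈ WaveletRegression.blockIndices p n j,
          P.real {ω | μ₁ * 2⁻¹ * (n : ℝ) ^ (-(1 / 2) : ℝ) ≤
            ((WaveletRegression.blockLength p n : ℝ)⁻¹ *
              ∑ k ∈ WaveletRegression.block p n j K,
                |WaveletRegression.empiricalCoeff ψ g (fun i => X i ω) (fun i => Y i ω) j k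
                  - WaveletRegression.waveletCoeff ψ f j k| ^ p) ^ (1 / p)}
            ≤ 4 * (n : ℝ) ^ (-p)) := by
  obtain ⟨R, hR, hψR⟩ := WaveletRegression.exists_tsum_enorm_sub_intCast_le
    hw.hasCompactSupport_mother hw.bounded_mother
  obtain ⟨μ₁, C, hμ₁, hC, general⟩ := proposition4p1_general p hp R hR M' hM'.le c hc
  refine ⟨μ₁, C, hμ₁, hC, 3, fun n hn f hf hfM g hg hcg Ω _ P _ X Y z hs j _ hj ↦ ?_⟩
  have ⟨moment, deviation⟩ := general ψ hw.measurable_mother hψR n hn f hf hfM g hg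
    (hcg.mono fun _ hx ↦ hx.1) Ω P X Y z hs j
    (WaveletRegression.two_pow_mul_log_le_of_le_finestLevel hn hj)
  refine ⟨moment, fun K _ ↦ (deviation _ (Finset.filter_subset _ _)
    (WaveletRegression.card_block_le_blockLength p n j K)).trans ?_⟩
  gcongr
  norm_num
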